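/- Conventions. A quadrilateral $ABCD$ is a quadruple of distinct points of $\mathbb R^2$ (possibly self-intersecting, possibly with collinear vertices). For a point $X\in\mathbb R^2$ other than the vertices, the pairs of lines $(XA,XC)$ and $(XB,XD)$ are isogonal if they have the same pair of angle bisectors; for a real point at infinity $X$ they are isogonal if, for any line $\ell$ not through $X$ that meets $XA,XB,XC,XD$ at $E,F,G,H\in\mathbb R^2$, the directed lengths $EF$ and $HG$ are equal. A non-degenerate (that is, irreducible) real cubic curve $\mathcal C\subset\mathbb{RP}^2$ is the isogonal cubic of $ABCD$ if it is the locus of all points $X\in\mathbb{RP}^2$ at which $(XA,XC)$ and $(XB,XD)$ are isogonal, the vertices $A,B,C,D$ being counted as points of the locus. The spiral center of $ABCD$ is the center $P$ of the spiral similarity that carries $A$ to $B$ and $D$ to $C$. Finally $I=(1:i:0)$ and $J=(1:-i:0)$ are the circular points at infinity in $\mathbb{CP}^2$. Theorem (Uniqueness of the Spiral Center). Let $\mathcal C\subset\mathbb{RP}^2$ be a non-degenerate cubic which is the isogonal cubic of a quadrilateral $ABCD$ with spiral center $P$, and let $\mathcal C_0$ be the embedding of $\mathcal C$ in $\mathbb{CP}^2$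 (the complex curve with the same equation). Then $I$ and $J$ are non-singular points of $\mathcal C_0$, and the lines $PI$ and $PJ$ are the tangents to $\mathcal C_0$ at $I$ and $J$ respectively. Consequently the spiral center is determined by the cubic alone: if $\mathcal C$ is also the isogonal cubic of a quadrilateral $A'B'C'D'$ with spiral center $P'$, then $P'=P$. -/

import Mathlib

open scoped LinearAlgebra.Projectivization

noncomputable section

namespace IsogonalCubic

/-- The Euclidean plane `ℝ²`. -/
abbrev Plane : Type := EuclideanSpace ℝ (Fin 2)

/-- The projective plane over `K`, with homogeneous coordinates `(x : y : z)`. -/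
abbrev ProjPlane (K : Type) [Field K] : Type := ℙ K (Fin 3 → K)

/-! ### Points -/

theorem affine_ne_zero {K : Type} [Field K] (x y : K) : (![x, y, 1] : Fin 3 → K) ≠ 0 := by
  intro h
  simpa using congrFun h 2

theorem infinite_ne_zero {d : Plane} (hd : d ≠ 0) : (![d 0, d 1, 0] : Fin 3 → ℝ) ≠ 0 := by
  intro h
  apply hd
  ext i
  fin_cases i
  · simpa using congrFun h 0
  · simpa using congrFun h 1

theorem circular_ne_zero (w : ℂ) : (![1, w, 0] : Fin 3 → ℂ) ≠ 0 := by
  intro h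
  simpa using congrFun h 0

/-- The point `(x : y : 1)` of `ℝℙ²` given by the point `(x, y)` of `ℝ²`. -/
def realPoint (X : Plane) : ProjPlane ℝ :=
  Projectivization.mk ℝ ![X 0, X 1, 1] (affine_ne_zero _ _)

/-- The real point at infinity in the direction `d ≠ 0`. -/
def pointAtInfinity (d : Plane) (hd : d ≠ 0) : ProjPlane ℝ :=
  Projectivization.mk ℝ ![d 0, d 1, 0] (infinite_ne_zero hd)

/-- The point `(x : y : 1)` of `ℂℙ²` given by the point `(x, y)` of `ℝ²`. -/
def complexPoint (X : Plane) : ProjPlane ℂ :=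
  Projectivization.mk ℂ ![(X 0 : ℂ), (X 1 : ℂ), 1] (affine_ne_zero _ _)

/-- The circular point at infinity `I = (1 : i : 0)`. -/
def circularI : ProjPlane ℂ :=
  Projectivization.mk ℂ ![1, Complex.I, 0] (circular_ne_zero _)

/-- The circular point at infinity `J = (1 : -i : 0)`. -/
def circularJ : ProjPlane ℂ :=
  Projectivization.mk ℂ ![1, -Complex.I, 0] (circular_ne_zero _)

/-! ### Plane projective curves, lines and tangents -/

/-- The set of points of the projective plane over `K` at which the form `F` vanishes. -/
def curve {K : Type} [Field K] (F : MvPolynomial (Fin 3) K) : Set (ProjPlane K) :=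
  {X | MvPolynomial.eval X.rep F = 0}

/-- `F` is the equation of a non-degenerate (that is, irreducible) cubic. -/
def IsNondegenerateCubic (F : MvPolynomial (Fin 3) ℝ) : Prop :=
  F.IsHomogeneous 3 ∧ Irreducible F

/-- The equation of the embedding in `ℂℙ²` of the real curve with equation `F`. -/
def complexify (F : MvPolynomial (Fin 3) ℝ) : MvPolynomial (Fin 3) ℂ :=
  MvPolynomial.map (algebraMap ℝ ℂ) F

/-- The projective line through `X` and `Y` (used for `X ≠ Y`). -/
def projLine {K : Type} [Field K] (X Y : ProjPlane K) : Set (ProjPlane K) :=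
  {Z | Z.submodule ≤ X.submodule ⊔ Y.submodule}

/-- `L` is the tangent line at `X` to the curve `F = 0`: the point `X` is a non-singular point of
the curve, and `L` has the equation `F_x(X) x + F_y(X) y + F_z(X) z = 0`. -/
def IsTangentAt {K : Type} [Field K] (F : MvPolynomial (Fin 3) K) (L : Set (ProjPlane K))
    (X : ProjPlane K) : Prop :=
  X ∈ curve F ∧
  (∃ i, MvPolynomial.eval X.rep (MvPolynomial.pderiv i F) ≠ 0) ∧
  L = {Z | ∑ i, MvPolynomial.eval X.rep (MvPolynomial.pderiv i F) * Z.rep i = 0}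

/-! ### Isogonality and the isogonal cubic -/

/-- The angle bisectors of the pair of lines `(XA, XC)`, for `A, C ≠ X`: the lines through `X`
such that the reflection in them carries the line `XA` to the line `XC`. -/
def angleBisectors (X A C : Plane) : Set (AffineSubspace ℝ Plane) :=
  {m | ∃ u : Plane, u ≠ 0 ∧ m = AffineSubspace.mk' X (ℝ ∙ u) ∧
    (ℝ ∙ (A - X)).map ((ℝ ∙ u).reflection.toLinearEquiv : Plane →ₗ[ℝ] Plane) = ℝ ∙ (C - X)}

/-- For a point `X` of `ℝ²` other than `A, B, C, D`: the pairs of lines `(XA, XC)` and `(XB, XD)`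
have the same pair of angle bisectors. -/
def IsIsogonalAt (X A B C D : Plane) : Prop :=
  angleBisectors X A C = angleBisectors X B D

/-- Isogonality at the real point at infinity in the direction `d`: if a line `ℓ` (not through that
point) meets the parallels to `d` through `A, B, C, D` at `E, F, G, H`, then the directed lengths
`EF` and `HG` are equal. -/
def IsIsogonalAtInfinity (d A B C D : Plane) : Prop :=
  ∀ (ℓ : AffineSubspace ℝ Plane) (E F G H : Plane),
    Module.finrank ℝ ℓ.direction = 1 → d ∉ ℓ.direction →
    E ∈ ℓ → F ∈ ℓ → G ∈ ℓ → H ∈ ℓ →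
    E ∈ AffineSubspace.mk' A (ℝ ∙ d) → F ∈ AffineSubspace.mk' B (ℝ ∙ d) →
    G ∈ AffineSubspace.mk' C (ℝ ∙ d) → H ∈ AffineSubspace.mk' D (ℝ ∙ d) →
    F - E = G - H

/-- A quadrilateral: four distinct vertices (possibly self-intersecting, possibly with collinear
vertices). -/
def IsQuadrilateral (A B C D : Plane) : Prop :=
  A ≠ B ∧ A ≠ C ∧ A ≠ D ∧ B ≠ C ∧ B ≠ D ∧ C ≠ D

/-- The locus in `ℝℙ²` of the points `X` at which `(XA, XC)` and `(XB, XD)` are isogonal. The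
vertices, where one of the lines is not defined, belong to the locus by convention. -/
def isogonalLocus (A B C D : Plane) : Set (ProjPlane ℝ) :=
  {X | (∃ Y : Plane, X = realPoint Y ∧
          ((Y = A ∨ Y = B ∨ Y = C ∨ Y = D) ∨ IsIsogonalAt Y A B C D)) ∨
       (∃ (d : Plane) (hd : d ≠ 0), X = pointAtInfinity d hd ∧ IsIsogonalAtInfinity d A B C D)}

/-- The real cubic with equation `F` is the isogonal cubic of `ABCD`. -/
def IsIsogonalCubicOf (F : MvPolynomial (Fin 3) ℝ) (A B C D : Plane) : Prop :=
  curve F = isogonalLocus A B C D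

/-! ### The spiral center -/

/-- The spiral similarity with center `P`, ratio `r` and angle `θ`. -/
def spiralSimilarity (P : Plane) (r θ : ℝ) (X : Plane) : Plane :=
  !₂[P 0 + r * (Real.cos θ * (X 0 - P 0) - Real.sin θ * (X 1 - P 1)),
     P 1 + r * (Real.sin θ * (X 0 - P 0) + Real.cos θ * (X 1 - P 1))]

/-- `P` is the spiral center of `ABCD`: the center of a spiral similarity that carries `A` to `B`
and `D` to `C` (for distinct vertices, equivalently `A` to `D` and `B` to `C`). -/
def IsSpiralCenter (P A B C D : Plane) : Prop :=
  ∃ r θ : ℝ, 0 < r ∧ spiralSimilarity P r θ A = B ∧ spiralSimilarity P r θ D = C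

end IsogonalCubic

end

/-! Identify the plane with the complex numbers. A finite point `Z` other than the vertices is
isogonal when `(Z - A)(Z - C)` and `(Z - B)(Z - D)` are real multiples of each other. The
degree-four part of this equation cancels, leaving a cubic `G` with top form `|Z|² Im(conj Z * d)`,
where `d = B + D - A - C`, so `G` passes through `I` and `J`.

Real zeros determine `F` up to a constant (`eq_C_mul_circularCubic`): if `F` did not divide `G`, a
combination of the two would be a nonzero form free of one variable, yet `G`, being cubic in that
variable, has a real root over every value of the others, and `F` vanishes there too when `z ≠ 0`.

The gradient of `G` at `(1 : j : 0)`, `j² = -1`, gives the tangent `d (x + j y) + e z = 0`, where `e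
= AC - BD` and `j` plays the role of `i` in `d` and `e`. The spiral center satisfies `(A - P)(C - P)
= (B - P)(D - P)`, that is `P d = -e`, so it lies on this tangent. The tangent at `I` contains only
one real finite point, hence uniqueness. -/

namespace IsogonalCubic

open MvPolynomial

/-! ### Divisibility from vanishing -/

/-- Two polynomials over a unique factorization domain, one of them irreducible and not dividing
the other, generate an ideal that contains a non-zero constant. -/
theorem exists_combination_eq_C {R : Type*} [CommRing R] [IsDomain R]
    [UniqueFactorizationMonoid R] {f g : Polynomial R} (hf : Irreducible f) (hfg : ¬ f ∣ g) :
    ∃ (s t : Polynomial R) (r : R), r ≠ 0 ∧ s * f + t * g = Polynomial.C r := by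
  by_cases h0 : f.natDegree = 0
  · obtain ⟨r, hr⟩ := Polynomial.natDegree_eq_zero.1 h0
    refine ⟨1, 0, r, ?_, by simp [hr]⟩
    rintro rfl
    exact hf.ne_zero (by simp [← hr])
  -- By Gauss's lemma `f` stays irreducible and a non-divisor over the fraction field; a Bézout
  -- identity there is cleared of denominators.
  · have hp : f.IsPrimitive := hf.isPrimitive h0
    let K := FractionRing R
    have hirr : Irreducible (f.map (algebraMap R K)) :=
      (hp.irreducible_iff_irreducible_map_fraction_map).1 hf
    have hnd : ¬ f.map (algebraMap R K) ∣ g.map (algebraMap R K) :=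
      fun h => hfg (hp.dvd_of_fraction_map_dvd_fraction_map h)
    obtain ⟨u, v, huv⟩ := (hirr.coprime_iff_not_dvd).2 hnd
    obtain ⟨b, hb, hu⟩ := IsLocalization.integerNormalization_spec (nonZeroDivisors R) u
    obtain ⟨c, hc, hv⟩ := IsLocalization.integerNormalization_spec (nonZeroDivisors R) v
    set u' := IsLocalization.integerNormalization (nonZeroDivisors R) u
    set v' := IsLocalization.integerNormalization (nonZeroDivisors R) v
    refine ⟨Polynomial.C c * u', Polynomial.C b * v', c * b,
      mul_ne_zero (nonZeroDivisors.ne_zero hc) (nonZeroDivisors.ne_zero hb), ?_⟩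
    apply Polynomial.map_injective (algebraMap R K) (IsFractionRing.injective R K)
    rw [Algebra.smul_def, Polynomial.algebraMap_apply] at hu hv
    simp only [Polynomial.map_add, Polynomial.map_mul, Polynomial.map_C, hu, hv]
    linear_combination (Polynomial.C (algebraMap R K c) * Polynomial.C (algebraMap R K b)) * huv +
      (Polynomial.C_mul (a := algebraMap R K c) (b := algebraMap R K b)).symm -
      congrArg Polynomial.C (map_mul (algebraMap R K) c b)

/-- An irreducible polynomial that vanishes at all zeros of `G` outside of `x₂ = 0` divides `G`,
provided that `G` has a zero with any prescribed values of `x₁` and `x₂`. -/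
theorem dvd_of_forall_eval_eq_zero {F G : MvPolynomial (Fin 3) ℝ} (hF : Irreducible F)
    (hroot : ∀ y z : ℝ, ∃ x : ℝ, eval ![x, y, z] G = 0)
    (hFG : ∀ v : Fin 3 → ℝ, v 2 ≠ 0 → eval v G = 0 → eval v F = 0) : F ∣ G := by
  by_contra hnd
  let e := finSuccEquiv ℝ 2
  have hF' : Irreducible (e F) := (MulEquiv.irreducible_iff e).2 hF
  have hnd' : ¬ e F ∣ e G := fun h => hnd ((map_dvd_iff e).1 h)
  obtain ⟨s, t, r, hr, h⟩ := exists_combination_eq_C hF' hnd'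
  -- Here `X 1` is the original `x₂`; this factor absorbs the excluded values `x₂ = 0`.
  have hv (w : Fin 2 → ℝ) : eval w (r * X 1) = 0 := by
    by_cases hw : w 1 = 0
    · simp [hw]
    obtain ⟨x, hx⟩ := hroot (w 0) (w 1)
    have hcons : (![x, w 0, w 1] : Fin 3 → ℝ) = Fin.cons x w := by
      ext i
      fin_cases i <;> rfl
    have hx' := hFG _ (by simpa using hw) hx
    rw [hcons, eval_eq_eval_mv_eval'] at hx hx'
    have h2 := congrArg (fun p => Polynomial.eval x (Polynomial.map (eval w) p)) h
    simp only [Polynomial.map_add, Polynomial.map_mul, Polynomial.eval_add, Polynomial.eval_mul,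
      Polynomial.map_C, Polynomial.eval_C] at h2
    have : eval w r = 0 := by
      rw [← h2]
      change _ * Polynomial.eval x (Polynomial.map (eval w) (finSuccEquiv ℝ 2 F)) +
        _ * Polynomial.eval x (Polynomial.map (eval w) (finSuccEquiv ℝ 2 G)) = 0
      rw [hx, hx', mul_zero, mul_zero, add_zero]
    simp [this]
  have hz : r * X 1 = 0 := MvPolynomial.funext (fun w => by rw [hv w, map_zero])
  rcases mul_eq_zero.1 hz with h | h
  · exact hr h
  · exact X_ne_zero _ h

theorem exists_root_of_cubic {a : ℝ} (ha : a ≠ 0) (p q r : ℝ) :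
    ∃ x : ℝ, a * x ^ 3 + p * x ^ 2 + q * x + r = 0 := by
  have key (p q r : ℝ) : ∃ x : ℝ, x ^ 3 + p * x ^ 2 + q * x + r = 0 := by
    -- At `±M` the cube dominates the lower terms, so the intermediate value theorem applies.
    set M : ℝ := 1 + |p| + |q| + |r| with hM
    have hM1 : 1 ≤ M := by linarith [abs_nonneg p, abs_nonneg q, abs_nonneg r]
    have hb (x : ℝ) (hx : |x| = M) : |p * x ^ 2 + q * x + r| < M ^ 3 := by
      have h1 : |p * x ^ 2 + q * x + r| ≤ |p| * M ^ 2 + |q| * M + |r| := by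
        refine (abs_add_le _ _).trans (add_le_add ((abs_add_le _ _).trans ?_) le_rfl)
        rw [abs_mul, abs_mul, abs_pow, hx]
      have h2 : |q| * M ≤ |q| * M ^ 2 := by
        gcongr
        nlinarith
      have h3 : |r| ≤ |r| * M ^ 2 := le_mul_of_one_le_right (abs_nonneg r) (by nlinarith)
      have h4 : M ^ 3 = M ^ 2 + |p| * M ^ 2 + |q| * M ^ 2 + |r| * M ^ 2 := by
        rw [hM]
        ring
      nlinarith
    have hpos := abs_lt.1 (hb M (abs_of_pos (by linarith)))
    have hneg := abs_lt.1 (hb (-M) (by rw [abs_neg, abs_of_pos (by linarith)]))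
    have hc : Continuous fun x : ℝ => x ^ 3 + p * x ^ 2 + q * x + r := by fun_prop
    refine mem_range_of_exists_le_of_exists_ge hc ⟨-M, ?_⟩ ⟨M, ?_⟩
    · have : (-M) ^ 3 = - M ^ 3 := by ring
      linarith
    · linarith
  obtain ⟨x, hx⟩ := key (p / a) (q / a) (r / a)
  refine ⟨x, ?_⟩
  field_simp at hx
  linear_combination hx

theorem eval_smul_of_isHomogeneous {K : Type*} [CommRing K] {σ : Type*} {n : ℕ}
    {F : MvPolynomial σ K} (hF : F.IsHomogeneous n) (c : K) (v : σ → K) :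
    eval (c • v) F = c ^ n * eval v F := by
  rw [eval_eq, eval_eq, Finset.mul_sum]
  refine Finset.sum_congr rfl fun d hd => ?_
  have hdeg : ∑ i ∈ d.support, d i = n := hF.degree_eq_sum_deg_support hd |>.symm
  simp only [Pi.smul_apply, smul_eq_mul, mul_pow, Finset.prod_mul_distrib,
    Finset.prod_pow_eq_pow_sum, hdeg]
  ring

/-! ### Circular cubics -/

/-- The cubic form whose part of top degree in `x, y` is `(x² + y²) (d₂ x - d₁ y)`. -/
noncomputable def circularCubic (d₁ d₂ e₁ e₂ k l₁ l₂ m : ℝ) : MvPolynomial (Fin 3) ℝ :=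
  (X 0 ^ 2 + X 1 ^ 2) * (C d₂ * X 0 - C d₁ * X 1) +
    X 2 * (C e₂ * (X 0 ^ 2 - X 1 ^ 2) - C (2 * e₁) * (X 0 * X 1) + C k * (X 0 ^ 2 + X 1 ^ 2)) +
    X 2 ^ 2 * (C l₂ * X 0 - C l₁ * X 1) + C m * X 2 ^ 3

theorem eval_circularCubic (d₁ d₂ e₁ e₂ k l₁ l₂ m x y z : ℝ) :
    eval ![x, y, z] (circularCubic d₁ d₂ e₁ e₂ k l₁ l₂ m) =
      (x ^ 2 + y ^ 2) * (d₂ * x - d₁ * y) +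
        z * (e₂ * (x ^ 2 - y ^ 2) - 2 * e₁ * (x * y) + k * (x ^ 2 + y ^ 2)) +
        z ^ 2 * (l₂ * x - l₁ * y) + m * z ^ 3 := by
  simp [circularCubic]

theorem isHomogeneous_circularCubic (d₁ d₂ e₁ e₂ k l₁ l₂ m : ℝ) :
    (circularCubic d₁ d₂ e₁ e₂ k l₁ l₂ m).IsHomogeneous 3 := by
  have hX (i : Fin 3) : (X i : MvPolynomial (Fin 3) ℝ).IsHomogeneous 1 := isHomogeneous_X ℝ i
  have hq : (X 0 ^ 2 + X 1 ^ 2 : MvPolynomial (Fin 3) ℝ).IsHomogeneous 2 :=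
    ((hX 0).pow 2).add ((hX 1).pow 2)
  exact (((hq.mul (((hX 0).C_mul d₂).sub ((hX 1).C_mul d₁))).add
    ((hX 2).mul (((((hX 0).pow 2).sub ((hX 1).pow 2)).C_mul e₂).sub
      (((hX 0).mul (hX 1)).C_mul (2 * e₁)) |>.add (hq.C_mul k)))).add
    (((hX 2).pow 2).mul (((hX 0).C_mul l₂).sub ((hX 1).C_mul l₁)))).add
    (((hX 2).pow 3).C_mul m)

/-- An irreducible cubic form that vanishes at all finite real zeros of a circular cubic is
proportional to it. -/
theorem eq_C_mul_circularCubic {d₁ d₂ e₁ e₂ k l₁ l₂ m : ℝ} (hd : d₁ ≠ 0 ∨ d₂ ≠ 0)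
    {F : MvPolynomial (Fin 3) ℝ} (hF : IsNondegenerateCubic F)
    (hFG : ∀ v : Fin 3 → ℝ, v 2 ≠ 0 →
      eval v (circularCubic d₁ d₂ e₁ e₂ k l₁ l₂ m) = 0 → eval v F = 0) :
    ∃ c : ℝ, c ≠ 0 ∧ F = C c * circularCubic d₁ d₂ e₁ e₂ k l₁ l₂ m := by
  set G := circularCubic d₁ d₂ e₁ e₂ k l₁ l₂ m with hG
  have hG0 : G ≠ 0 := by
    intro h
    have h1 := eval_circularCubic d₁ d₂ e₁ e₂ k l₁ l₂ m 1 0 0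
    have h2 := eval_circularCubic d₁ d₂ e₁ e₂ k l₁ l₂ m 0 1 0
    rw [← hG, h] at h1 h2
    simp at h1 h2
    rcases hd with hd | hd
    · exact hd h2
    · exact hd h1.symm
  have hdvd : F ∣ G := by
    by_cases h2 : d₂ = 0
    · have h1 : d₁ ≠ 0 := hd.resolve_right (not_not.2 h2)
      -- The `x³` coefficient `d₂` vanishes, but that of `y³` is `-d₁ ≠ 0`: exchange `x` and `y`.
      let e := renameEquiv ℝ (Equiv.swap (0 : Fin 3) 1)
      have hev (v : Fin 3 → ℝ) (p : MvPolynomial (Fin 3) ℝ) :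
          eval v (e p) = eval ![v 1, v 0, v 2] p := by
        rw [renameEquiv_apply, eval_rename]
        congr 2
        ext i
        fin_cases i <;> simp [Equiv.swap_apply_of_ne_of_ne]
      refine (map_dvd_iff e).1 (dvd_of_forall_eval_eq_zero ((MulEquiv.irreducible_iff e).2 hF.2)
        (fun y z => ?_) (fun v hv h => ?_))
      · obtain ⟨x, hx⟩ := exists_root_of_cubic (neg_ne_zero.2 h1) (d₂ * y + z * (k - e₂))
          (-d₁ * y ^ 2 - z * 2 * e₁ * y - z ^ 2 * l₁)
          (d₂ * y ^ 3 + z * (e₂ + k) * y ^ 2 + z ^ 2 * l₂ * y + m * z ^ 3)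
        refine ⟨x, ?_⟩
        rw [hev]
        simp only [Matrix.cons_val]
        rw [eval_circularCubic]
        linear_combination hx
      · rw [hev] at h ⊢
        exact hFG _ (by simpa using hv) h
    · refine dvd_of_forall_eval_eq_zero hF.2 (fun y z => ?_) hFG
      obtain ⟨x, hx⟩ := exists_root_of_cubic h2 (-d₁ * y + z * (k + e₂))
          (d₂ * y ^ 2 - z * 2 * e₁ * y + z ^ 2 * l₂)
          (-d₁ * y ^ 3 + z * (k - e₂) * y ^ 2 - z ^ 2 * l₁ * y + m * z ^ 3)
      refine ⟨x, ?_⟩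
      rw [eval_circularCubic]
      linear_combination hx
  obtain ⟨H, hH⟩ := hdvd
  have hH0 : H ≠ 0 := by
    rintro rfl
    exact hG0 (by rw [hH, mul_zero])
  -- Both forms have degree 3, so the cofactor is constant.
  have hdeg := totalDegree_mul_of_isDomain hF.2.ne_zero hH0
  rw [← hH, (isHomogeneous_circularCubic ..).totalDegree hG0,
    hF.1.totalDegree hF.2.ne_zero] at hdeg
  have hHC := totalDegree_eq_zero_iff_eq_C.1 (show H.totalDegree = 0 by omega)
  set c := coeff 0 H
  have hc : c ≠ 0 := by
    intro h
    rw [h, map_zero] at hHC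
    exact hH0 hHC
  refine ⟨c⁻¹, inv_ne_zero hc, ?_⟩
  rw [hH, hHC, mul_left_comm, ← map_mul, inv_mul_cancel₀ hc, map_one, mul_one]

/-! ### Tangents at the circular points -/

/-- The line through a real point `P` and the point `(1 : j : 0)`, where `j² = -1`. -/
theorem mem_projLine_circular {j : ℂ} (hj : j * j = -1) (P : Plane) (Z : ProjPlane ℂ) :
    Z ∈ projLine (complexPoint P) (Projectivization.mk ℂ ![1, j, 0] (circular_ne_zero j)) ↔
      Z.rep 0 + j * Z.rep 1 = (P 0 + j * P 1) * Z.rep 2 := by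
  change Z.submodule ≤ _ ⊔ _ ↔ _
  rw [Projectivization.submodule_eq, complexPoint, Projectivization.submodule_mk,
    Projectivization.submodule_mk, Submodule.span_singleton_le_iff_mem, ← Submodule.span_insert,
    Submodule.mem_span_pair]
  constructor
  · rintro ⟨a, b, h⟩
    rw [← h]
    simp
    linear_combination b * hj
  · intro h
    refine ⟨Z.rep 2, Z.rep 0 - Z.rep 2 * P 0, ?_⟩
    ext i
    fin_cases i
    · simp
    · simp
      linear_combination j * h - (Z.rep 1 - P 1 * Z.rep 2) * hj
    · simp

/-- The line has equation `x + i y = (P 0 + i P 1) z`; at a real finite point, real and imaginary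
parts recover both coordinates. -/
theorem projLine_circular_injective {P P' : Plane}
    (h : projLine (complexPoint P) circularI = projLine (complexPoint P') circularI) : P' = P := by
  have hmem : complexPoint P' ∈ projLine (complexPoint P) circularI := by
    rw [h]
    exact le_sup_left (a := (complexPoint P').submodule)
  rw [circularI, mem_projLine_circular Complex.I_mul_I] at hmem
  obtain ⟨a, ha⟩ := Projectivization.exists_smul_eq_mk_rep ℂ
    (![(P' 0 : ℂ), (P' 1 : ℂ), 1]) (affine_ne_zero _ _)
  rw [complexPoint, ← ha] at hmem
  simp only [Pi.smul_apply, Units.smul_def, smul_eq_mul, Matrix.cons_val] at hmem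
  have h2 : (P' 0 + Complex.I * P' 1 : ℂ) = P 0 + Complex.I * P 1 :=
    mul_left_cancel₀ a.ne_zero (by linear_combination hmem)
  have hre := congrArg Complex.re h2
  have him := congrArg Complex.im h2
  simp at hre him
  ext i
  fin_cases i
  · exact hre
  · exact him

/-- The tangent to a circular cubic at `(1 : j : 0)`, where `j² = -1`. -/
theorem isTangentAt_circularCubic {j : ℂ} (hj : j * j = -1) {d₁ d₂ e₁ e₂ k l₁ l₂ m c : ℝ}
    (hc : c ≠ 0) {P : Plane} (hd : (d₁ + j * d₂ : ℂ) ≠ 0)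
    (hP : (P 0 + j * P 1 : ℂ) * (d₁ + j * d₂) = -(e₁ + j * e₂)) :
    IsTangentAt (complexify (C c * circularCubic d₁ d₂ e₁ e₂ k l₁ l₂ m))
      (projLine (complexPoint P) (Projectivization.mk ℂ ![1, j, 0] (circular_ne_zero j)))
      (Projectivization.mk ℂ ![1, j, 0] (circular_ne_zero j)) := by
  obtain ⟨a, ha⟩ := Projectivization.exists_smul_eq_mk_rep ℂ ![1, j, 0] (circular_ne_zero j)
  have ha0 : (a : ℂ) ≠ 0 := a.ne_zero
  have hc0 : (c : ℂ) ≠ 0 := by exact_mod_cast hc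
  have hj0 : j ≠ 0 := by
    rintro rfl
    simp at hj
  set Y := Projectivization.mk ℂ ![1, j, 0] (circular_ne_zero j)
  have hY0 : Y.rep 0 = a := by simp [← ha, Units.smul_def]
  have hY1 : Y.rep 1 = a * j := by simp [← ha, Units.smul_def]
  have hY2 : Y.rep 2 = 0 := by simp [← ha]
  set F := complexify (C c * circularCubic d₁ d₂ e₁ e₂ k l₁ l₂ m) with hF
  -- Modulo `j² = -1` the gradient is a multiple of `(d, j d, e)`, with `d = d₁ + j d₂` and `e = e₁
  -- + j e₂`; the `k` term dies since `1 + j² = 0`.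
  have g0 : eval Y.rep (pderiv 0 F) = -2 * c * a ^ 2 * j * (d₁ + j * d₂) := by
    simp [hF, complexify, circularCubic, pderiv_X, hY0, hY1, hY2,
      Derivation.leibniz]
    linear_combination (3 * c * a ^ 2 * d₂) * hj
  have g1 : eval Y.rep (pderiv 1 F) = -2 * c * a ^ 2 * j * (d₁ + j * d₂) * j := by
    simp [hF, complexify, circularCubic, pderiv_X, hY0, hY1, hY2,
      Derivation.leibniz]
    linear_combination (c * a ^ 2 * (2 * j * d₂ - d₁)) * hj
  have g2 : eval Y.rep (pderiv 2 F) = -2 * c * a ^ 2 * j * (e₁ + j * e₂) := by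
    simp [hF, complexify, circularCubic, pderiv_X, hY0, hY1, hY2,
      Derivation.leibniz]
    linear_combination (c * a ^ 2 * (e₂ + k)) * hj
  have hu : (-2 * c * a ^ 2 * j : ℂ) ≠ 0 := by
    simp [hc0, ha0, hj0]
  refine ⟨?_, ⟨0, ?_⟩, ?_⟩
  · change eval Y.rep F = 0
    simp only [hF, complexify, circularCubic, map_mul, map_add, map_sub, map_pow, map_C, map_X, eval_C,
      eval_X, hY0, hY1, hY2, Complex.coe_algebraMap]
    linear_combination (c * a ^ 3 * (d₂ - d₁ * j)) * hj
  · rw [g0]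
    exact mul_ne_zero hu hd
  · ext Z
    rw [mem_projLine_circular hj, Set.mem_ofPred_eq, Fin.sum_univ_three, g0, g1, g2]
    constructor
    · intro h
      linear_combination (-2 * c * a ^ 2 * j * (d₁ + j * d₂)) * h +
        (-2 * c * a ^ 2 * j * Z.rep 2) * hP
    · intro h
      apply mul_left_cancel₀ (mul_ne_zero hu hd)
      linear_combination h - (-2 * c * a ^ 2 * j * Z.rep 2) * hP

/-! ### The equation of the isogonal cubic -/

theorem span_singleton_eq_iff_cross {p q : Plane} (hp : p ≠ 0) (hq : q ≠ 0) :
    (ℝ ∙ p) = ℝ ∙ q ↔ p 0 * q 1 - p 1 * q 0 = 0 := by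
  rw [Submodule.span_singleton_eq_span_singleton]
  constructor
  · rintro ⟨z, rfl⟩
    simp [Units.smul_def]
    ring
  · intro h
    have hex : ∃ i, p i ≠ 0 := by
      by_contra! h0
      exact hp (by ext i; exact h0 i)
    obtain ⟨z, hz⟩ : ∃ z : ℝ, z • p = q := by
      obtain ⟨i, hi⟩ := hex
      refine ⟨q i / p i, ?_⟩
      ext k
      rw [PiLp.smul_apply, smul_eq_mul]
      field_simp
      fin_cases i <;> fin_cases k <;> simp <;> linarith
    have hz0 : z ≠ 0 := by
      rintro rfl
      exact hq (by rw [← hz, zero_smul])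
    exact ⟨Units.mk0 z hz0, hz⟩

/-- The reflection in the line spanned by `u` carries the line spanned by `a` to the line spanned by
`c` if and only if `u²` and `ac`, as complex numbers, are real multiples of each other. -/
theorem map_reflection_span_eq_iff {u a c : Plane} (hu : u ≠ 0) (ha : a ≠ 0) (hc : c ≠ 0) :
    (ℝ ∙ a).map ((ℝ ∙ u).reflection.toLinearEquiv : Plane →ₗ[ℝ] Plane) = ℝ ∙ c ↔
      (u 0 ^ 2 - u 1 ^ 2) * (a 0 * c 1 + a 1 * c 0) =
        2 * (u 0 * u 1) * (a 0 * c 0 - a 1 * c 1) := by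
  have hr : (ℝ ∙ u).reflection a ≠ 0 := by simpa using ha
  have hn : ‖u‖ ^ 2 ≠ 0 := by simpa using hu
  have hn' : ‖u‖ ^ 2 = u 0 ^ 2 + u 1 ^ 2 := by
    simp [EuclideanSpace.norm_sq_eq, Fin.sum_univ_two]
  have hmap : (ℝ ∙ a).map ((ℝ ∙ u).reflection.toLinearEquiv : Plane →ₗ[ℝ] Plane) =
      ℝ ∙ ((ℝ ∙ u).reflection a) := by
    rw [Submodule.map_span, Set.image_singleton]
    rfl
  -- The reflection of `a` is `u² conj(a) / |u|²`, so it is parallel to `c` exactly when `u²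
  -- conj(ac)` is real.
  rw [hmap, span_singleton_eq_iff_cross hr hc, Submodule.reflection_singleton_apply]
  have hin : inner ℝ u a = u 0 * a 0 + u 1 * a 1 := by
    simp [PiLp.inner_apply, Fin.sum_univ_two, mul_comm]
  simp only [RCLike.ofReal_real_eq_id, id, hin, PiLp.sub_apply, PiLp.smul_apply, smul_eq_mul,
    nsmul_eq_mul, Nat.cast_ofNat]
  rw [hn'] at hn ⊢
  constructor
  · intro h
    field_simp at h
    linear_combination h
  · intro h
    field_simp
    linear_combination h

theorem eq_zero_of_sq_add_sq {p : Plane} (hp : p 0 ^ 2 + p 1 ^ 2 = 0) : p = 0 := by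
  rw [← norm_eq_zero, ← sq_eq_zero_iff, EuclideanSpace.norm_sq_eq, Fin.sum_univ_two]
  simpa using hp

/-- These are the real and imaginary parts of `ac`, and `|ac|² = |a|² |c|²`. -/
theorem complex_mul_ne_zero {a c : Plane} (ha : a ≠ 0) (hc : c ≠ 0) :
    a 0 * c 0 - a 1 * c 1 ≠ 0 ∨ a 0 * c 1 + a 1 * c 0 ≠ 0 := by
  by_contra! h
  have h1 : (a 0 ^ 2 + a 1 ^ 2) * (c 0 ^ 2 + c 1 ^ 2) = 0 := by
    linear_combination (a 0 * c 0 - a 1 * c 1) * h.1 + (a 0 * c 1 + a 1 * c 0) * h.2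
  rcases mul_eq_zero.1 h1 with h1 | h1
  · exact ha (eq_zero_of_sq_add_sq h1)
  · exact hc (eq_zero_of_sq_add_sq h1)

/-- Parallelism is transitive through a nonzero vector. It transfers the bisector condition on `u²`
between `ac` and `bd`. -/
theorem eq_zero_of_parallel {m₁ m₂ n₁ n₂ s t : ℝ} (hm : m₁ ≠ 0 ∨ m₂ ≠ 0)
    (h : m₂ * n₁ = m₁ * n₂) (h1 : s * m₂ = t * m₁) : s * n₂ = t * n₁ := by
  rcases hm with hm | hm <;> apply mul_left_cancel₀ hm
  · linear_combination -s * h + n₁ * h1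
  · linear_combination n₂ * h1 - t * h

/-- If `ac` and `bd`, as complex numbers, are real multiples of each other, for the vectors
`a, b, c, d` from `X` to the vertices, then `X` is isogonal. -/
theorem isIsogonalAt_of_parallel {X A B C D : Plane} (hA : X ≠ A) (hB : X ≠ B) (hC : X ≠ C)
    (hD : X ≠ D)
    (h : ((A - X) 0 * (C - X) 1 + (A - X) 1 * (C - X) 0) *
          ((B - X) 0 * (D - X) 0 - (B - X) 1 * (D - X) 1) =
        ((A - X) 0 * (C - X) 0 - (A - X) 1 * (C - X) 1) *
          ((B - X) 0 * (D - X) 1 + (B - X) 1 * (D - X) 0)) : IsIsogonalAt X A B C D := by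
  have hA' := sub_ne_zero.2 hA.symm
  have hB' := sub_ne_zero.2 hB.symm
  have hC' := sub_ne_zero.2 hC.symm
  have hD' := sub_ne_zero.2 hD.symm
  refine Set.ext fun m => exists_congr fun u => and_congr_right fun hu => and_congr_right fun _ => ?_
  rw [map_reflection_span_eq_iff hu hA' hC', map_reflection_span_eq_iff hu hB' hD']
  exact ⟨eq_zero_of_parallel (complex_mul_ne_zero hA' hC') h,
    eq_zero_of_parallel (complex_mul_ne_zero hB' hD') (by linear_combination -h)⟩

/-- The circular cubic with affine equation `Im ((Z - A) (Z - C) conj ((Z - B) (Z - D))) = 0`. -/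
noncomputable def isogonalForm (A B C D : Plane) : MvPolynomial (Fin 3) ℝ :=
  circularCubic (B 0 + D 0 - A 0 - C 0) (B 1 + D 1 - A 1 - C 1)
    ((A 0 * C 0 - A 1 * C 1) - (B 0 * D 0 - B 1 * D 1))
    ((A 0 * C 1 + A 1 * C 0) - (B 0 * D 1 + B 1 * D 0))
    ((A 1 + C 1) * (B 0 + D 0) - (A 0 + C 0) * (B 1 + D 1))
    (((A 0 + C 0) * (B 0 * D 0 - B 1 * D 1) + (A 1 + C 1) * (B 0 * D 1 + B 1 * D 0)) -
      ((A 0 * C 0 - A 1 * C 1) * (B 0 + D 0) + (A 0 * C 1 + A 1 * C 0) * (B 1 + D 1)))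
    (((A 0 + C 0) * (B 0 * D 1 + B 1 * D 0) - (A 1 + C 1) * (B 0 * D 0 - B 1 * D 1)) -
      ((A 0 * C 1 + A 1 * C 0) * (B 0 + D 0) - (A 0 * C 0 - A 1 * C 1) * (B 1 + D 1)))
    ((A 0 * C 1 + A 1 * C 0) * (B 0 * D 0 - B 1 * D 1) -
      (A 0 * C 0 - A 1 * C 1) * (B 0 * D 1 + B 1 * D 0))

theorem mem_isogonalLocus_of_eval_eq_zero {X A B C D : Plane}
    (h : eval ![X 0, X 1, 1] (isogonalForm A B C D) = 0) :
    realPoint X ∈ isogonalLocus A B C D := by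
  refine Or.inl ⟨X, rfl, ?_⟩
  by_cases hv : X = A ∨ X = B ∨ X = C ∨ X = D
  · exact Or.inl hv
  · push Not at hv
    refine Or.inr (isIsogonalAt_of_parallel hv.1 hv.2.1 hv.2.2.1 hv.2.2.2 ?_)
    rw [isogonalForm, eval_circularCubic] at h
    simp only [PiLp.sub_apply]
    linear_combination h

theorem eval_eq_zero_of_mem_curve {F : MvPolynomial (Fin 3) ℝ} {n : ℕ} (hF : F.IsHomogeneous n)
    {X : Plane} (hX : realPoint X ∈ curve F) : eval ![X 0, X 1, 1] F = 0 := by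
  obtain ⟨a, ha⟩ := Projectivization.exists_smul_eq_mk_rep ℝ ![X 0, X 1, 1] (affine_ne_zero _ _)
  change eval (realPoint X).rep F = 0 at hX
  rw [realPoint, ← ha, Units.smul_def, eval_smul_of_isHomogeneous hF] at hX
  exact (mul_eq_zero.1 hX).resolve_left (pow_ne_zero _ a.ne_zero)

/-- Homogeneity reduces to `z = 1`, where zeros of the isogonal form lie in the locus. This supplies
the vanishing needed for divisibility. -/
theorem eval_eq_zero_of_eval_isogonalForm_eq_zero {F : MvPolynomial (Fin 3) ℝ} {n : ℕ}
    (hF : F.IsHomogeneous n) {A B C D : Plane} (hC : IsIsogonalCubicOf F A B C D)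
    {v : Fin 3 → ℝ} (hv : v 2 ≠ 0) (h : eval v (isogonalForm A B C D) = 0) : eval v F = 0 := by
  let X : Plane := !₂[v 0 / v 2, v 1 / v 2]
  have hvX : v = v 2 • ![X 0, X 1, 1] := by
    ext i
    fin_cases i <;> simp [X] <;> field_simp
  have hG : (isogonalForm A B C D).IsHomogeneous 3 := isHomogeneous_circularCubic ..
  rw [hvX, eval_smul_of_isHomogeneous hG] at h
  have hX := mem_isogonalLocus_of_eval_eq_zero ((mul_eq_zero.1 h).resolve_left (pow_ne_zero _ hv))
  rw [← (show curve F = _ from hC)] at hX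
  rw [hvX, eval_smul_of_isHomogeneous hF, eval_eq_zero_of_mem_curve hF hX, mul_zero]

/-! ### The spiral center -/

/-- In complex notation, `P (A + C - B - D) = AC - BD`. -/
theorem IsSpiralCenter.mul_eq {P A B C D : Plane} (hP : IsSpiralCenter P A B C D) :
    P 0 * (A 0 + C 0 - B 0 - D 0) - P 1 * (A 1 + C 1 - B 1 - D 1) =
        (A 0 * C 0 - A 1 * C 1) - (B 0 * D 0 - B 1 * D 1) ∧
      P 0 * (A 1 + C 1 - B 1 - D 1) + P 1 * (A 0 + C 0 - B 0 - D 0) =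
        (A 0 * C 1 + A 1 * C 0) - (B 0 * D 1 + B 1 * D 0) := by
  -- With `w = r exp(iθ)`, `B - P = w (A - P)` and `C - P = w (D - P)`, so `(A - P)(C - P) = (B -
  -- P)(D - P)`, where `P²` cancels.
  obtain ⟨r, θ, -, rfl, rfl⟩ := hP
  simp only [spiralSimilarity, PiLp.toLp_apply, Matrix.cons_val]
  constructor <;> ring

/-- A quadrilateral that has a spiral center is not a parallelogram. -/
theorem IsSpiralCenter.not_parallelogram {P A B C D : Plane} (hP : IsSpiralCenter P A B C D)
    (hAB : A ≠ B) (hAD : A ≠ D) :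
    B 0 + D 0 - A 0 - C 0 ≠ 0 ∨ B 1 + D 1 - A 1 - C 1 ≠ 0 := by
  by_contra! h
  obtain ⟨r, θ, -, h1, h2⟩ := hP
  have hB0 := congrArg (fun X : Plane => X 0) h1
  have hB1 := congrArg (fun X : Plane => X 1) h1
  have hC0 := congrArg (fun X : Plane => X 0) h2
  have hC1 := congrArg (fun X : Plane => X 1) h2
  simp only [spiralSimilarity, PiLp.toLp_apply, Matrix.cons_val] at hB0 hB1 hC0 hC1
  -- Put `w = p + i q`. For a parallelogram `A - D = B - C = w (A - D)`; as `A ≠ D`, `w = 1`, which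
  -- forces `A = B`.
  obtain ⟨p, hp⟩ : ∃ p, p = r * Real.cos θ := ⟨_, rfl⟩
  obtain ⟨q, hq⟩ : ∃ q, q = r * Real.sin θ := ⟨_, rfl⟩
  have e0 : (p - 1) * (A 0 - D 0) - q * (A 1 - D 1) = 0 := by
    rw [hp, hq]
    linear_combination hB0 - hC0 + h.1
  have e1 : q * (A 0 - D 0) + (p - 1) * (A 1 - D 1) = 0 := by
    rw [hp, hq]
    linear_combination hB1 - hC1 + h.2
  have e : ((p - 1) ^ 2 + q ^ 2) * ((A 0 - D 0) ^ 2 + (A 1 - D 1) ^ 2) = 0 := by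
    linear_combination ((p - 1) * (A 0 - D 0) - q * (A 1 - D 1)) * e0 +
      (q * (A 0 - D 0) + (p - 1) * (A 1 - D 1)) * e1
  rcases mul_eq_zero.1 e with e | e
  · have hp1 : p = 1 := by nlinarith [sq_nonneg (p - 1), sq_nonneg q]
    have hq0 : q = 0 := by nlinarith [sq_nonneg (p - 1), sq_nonneg q]
    rw [hp] at hp1
    rw [hq] at hq0
    apply hAB
    ext i
    fin_cases i
    · change A 0 = B 0
      linear_combination hB0 - (A 0 - P 0) * hp1 + (A 1 - P 1) * hq0
    · change A 1 = B 1
      linear_combination hB1 - (A 0 - P 0) * hq0 - (A 1 - P 1) * hp1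
  · exact hAD (sub_eq_zero.1 (eq_zero_of_sq_add_sq e))

/-- The tangents to an isogonal cubic at the circular points pass through the spiral center. -/
theorem isTangentAt_circular {F : MvPolynomial (Fin 3) ℝ} (hF : IsNondegenerateCubic F)
    {A B C D P : Plane} (hQ : IsQuadrilateral A B C D) (hC : IsIsogonalCubicOf F A B C D)
    (hP : IsSpiralCenter P A B C D) {j : ℂ} (hj : j = Complex.I ∨ j = -Complex.I) :
    IsTangentAt (complexify F)
      (projLine (complexPoint P) (Projectivization.mk ℂ ![1, j, 0] (circular_ne_zero j)))
      (Projectivization.mk ℂ ![1, j, 0] (circular_ne_zero j)) := by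
  have hd := hP.not_parallelogram hQ.1 hQ.2.2.1
  obtain ⟨c, hc, hFc⟩ := eq_C_mul_circularCubic hd hF
    (fun v hv h => eval_eq_zero_of_eval_isogonalForm_eq_zero hF.1 hC hv h)
  have hjj : j * j = -1 := by
    rcases hj with rfl | rfl <;> simp
  rw [hFc]
  refine isTangentAt_circularCubic hjj hc ?_ ?_
  · intro h
    have hre := congrArg Complex.re h
    have him := congrArg Complex.im h
    rcases hj with rfl | rfl <;> simp at hre him <;> rcases hd with hd | hd <;>
      apply hd <;> linarith
  · have h0 := congrArg (fun x : ℝ => (x : ℂ)) hP.mul_eq.1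
    have h1 := congrArg (fun x : ℝ => (x : ℂ)) hP.mul_eq.2
    push_cast at h0 h1 ⊢
    linear_combination -h0 - j * h1 + P 1 * (B 1 + D 1 - A 1 - C 1) * hjj

end IsogonalCubic

theorem mainTheorem4
    (F : MvPolynomial (Fin 3) ℝ) (hF : IsogonalCubic.IsNondegenerateCubic F)
    (A B C D P : IsogonalCubic.Plane)
    (hABCD : IsogonalCubic.IsQuadrilateral A B C D)
    (hC : IsogonalCubic.IsIsogonalCubicOf F A B C D)
    (hP : IsogonalCubic.IsSpiralCenter P A B C D) :
    IsogonalCubic.IsTangentAt (IsogonalCubic.complexify F)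
      (IsogonalCubic.projLine (IsogonalCubic.complexPoint P) IsogonalCubic.circularI)
      IsogonalCubic.circularI ∧
    IsogonalCubic.IsTangentAt (IsogonalCubic.complexify F)
      (IsogonalCubic.projLine (IsogonalCubic.complexPoint P) IsogonalCubic.circularJ)
      IsogonalCubic.circularJ ∧
    (∀ A' B' C' D' P' : IsogonalCubic.Plane,
      IsogonalCubic.IsQuadrilateral A' B' C' D' →
      IsogonalCubic.IsIsogonalCubicOf F A' B' C' D' →
      IsogonalCubic.IsSpiralCenter P' A' B' C' D' →
      P' = P) := by
  have hI := IsogonalCubic.isTangentAt_circular hF hABCD hC hP (.inl rfl)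
  refine ⟨hI, IsogonalCubic.isTangentAt_circular hF hABCD hC hP (.inr rfl), ?_⟩
  intro A' B' C' D' P' hQ' hC' hP'
  have hI' := IsogonalCubic.isTangentAt_circular hF hQ' hC' hP' (.inl rfl)
  -- Both lines equal the zero set of the same gradient equation, which depends only on `F` and `I`.
  exact IsogonalCubic.projLine_circular_injective (hI.2.2.trans hI'.2.2.symm)
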